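/- **J expressions.** Let $\Sigma$ be a finite nonempty alphabet. J expressions over $\Sigma$ are formed as follows: $\varepsilon$ and every $a\in\Sigma$ are J expressions; if $\alpha,\beta$ are J expressions, so is $(\alpha\cup\beta)$; if $\alpha,\beta$ are J expressions different from the expression $\varepsilon$, then $(\alpha\beta)$ and $(\alpha^+)$ are J expressions; if $\beta_1,\dots,\beta_k$ ($k\ge 1$) are J expressions in which neither union nor positive closure occurs, then $\beta_1^{n_1}\cdots\beta_k^{n_k}$ is a J expression, where each exponent $n_j$ is either a fixed positive integer or an integer variable, and the same variable may be used several times. Union, concatenation and positive closure denote the usual operations on languages, and $\beta_1^{n_1}\cdots\beta_k^{n_k}$ denotes the union, over all assignments of positive integers to its variables, of the languages $L(\beta_1)^{n_1}\cdots L(\beta_k)^{n_k}$ (the variables are local to this exponentiation). A *J language* is a language $L(\alpha)$ denoted by a J expression $\alpha$. A set $S\subseteq\mathbb N^{\Sigma}$ is *represented* by a language $L$ if $S$ is the set of the vectors $(|w|_a)_{a\in\Sigma}$, $w\in L$, where $|w|_a$ is the number of occurrences of $a$ in $w$. **J P/T systems.** A *J P/T system* over $\Sigma$ is a place/transition net with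 finitely many places and transitions, all arc weights $1$ and all capacities infinite, with pairwise distinct input places $p_a$ ($a\in\Sigma$), all other places being called work places, and with an initial place $p_{init}$ and a final place $p_{fin}$ among the work places (possibly equal), such that every transition is a join with input set $\{p_a,w\}$ and output set $\{w'\}$ for some $a\in\Sigma$ and distinct work places $w\ne w'$. On input $v\in\mathbb N^{\Sigma}$ the initial configuration $C_v$ has $v_a$ tokens in each $p_a$, one token in $p_{init}$ and no other tokens. The vector $v$ is *accepted* if there is a configuration $C_{fin}$ reachable from $C_v$ by a (possibly empty) path of single firings, in which no transition can fire, with $C_{fin}(p_{fin})>0$, and such that every other configuration $D$ on a path from $C_v$ to $C_{fin}$ has $D(p_{fin})=0$. The system accepts the set $S$ if $S$ is exactly the set of the vectors that it accepts. **Theorem.** Let $S\subseteq\mathbb N^{\Sigma}$ be nonempty. 1. If $0\notin S$ or $S=\{0\}$, then $S$ is represented by a J language if and only if $S$ is accepted by a J P/T system. 2. In any case, if $S$ is accepted by a J P/T system, then $S$ is represented by a J language; and if $S$ is represented by a J language, then $S\setminus\{0\}$ is accepted by a J P/T system. That is, J languages and J P/T systems describe the same nonempty sets of vectors, up to the empty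 word (the zero vector). -/

import Mathlib

open scoped Computability

/-- An exponent: a fixed positive integer, or an integer variable (named by a natural number)
ranging over the positive integers. -/
inductive JExponent : Type
  | const (n : ℕ+) : JExponent
  | var (x : ℕ) : JExponent

/-- The value of an exponent under an assignment of positive integers to the variables. -/
def JExponent.val (ν : ℕ → ℕ+) : JExponent → ℕ
  | .const n => (n : ℕ)
  | .var x => (ν x : ℕ)

/-- Raw expressions over the alphabet `A`. The constructor `expo` is the exponentiation
`β₀ ^ n₀ ⋯ βₖ ^ nₖ`; two of its exponents are specified to be equal by using the same variable.
The side conditions of the formation rules are in `JExpr.WellFormed`. -/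
inductive JExpr (A : Type*) : Type _
  | eps : JExpr A
  | sym (a : A) : JExpr A
  | union (α β : JExpr A) : JExpr A
  | concat (α β : JExpr A) : JExpr A
  | plus (α : JExpr A) : JExpr A
  | expo (k : ℕ) (β : Fin (k + 1) → JExpr A) (n : Fin (k + 1) → JExponent) : JExpr A

namespace JExpr

variable {A : Type*}

/-- Neither the operator union nor the operator positive closure occurs in the expression. -/
def UnionPlusFree : JExpr A → Prop
  | eps => True
  | sym _ => True
  | union _ _ => False
  | concat α β => α.UnionPlusFree ∧ β.UnionPlusFree
  | plus _ => False
  | expo _ β _ => ∀ j, (β j).UnionPlusFree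

/-- The raw expression is a J expression. -/
def WellFormed : JExpr A → Prop
  | eps => True
  | sym _ => True
  | union α β => α.WellFormed ∧ β.WellFormed
  | concat α β => α.WellFormed ∧ β.WellFormed ∧ α ≠ eps ∧ β ≠ eps
  | plus α => α.WellFormed ∧ α ≠ eps
  | expo _ β _ => ∀ j, (β j).WellFormed ∧ (β j).UnionPlusFree

/-- The language denoted by an expression. The variables of an exponentiation are local to it:
its language is the union, over all assignments `ν` of positive integers to the variables, of the
concatenations of the powers of the languages of its terms. -/
def lang : JExpr A → Language A
  | eps => 1
  | sym a => {[a]}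
  | union α β => α.lang + β.lang
  | concat α β => α.lang * β.lang
  | plus α => α.lang * (α.lang)∗
  | expo _ β n =>
      {w : List A | ∃ ν : ℕ → ℕ+, w ∈ (List.ofFn fun j => (β j).lang ^ (n j).val ν).prod}

end JExpr

/-- J languages. -/
def IsJLanguage {A : Type*} (L : Language A) : Prop :=
  ∃ α : JExpr A, α.WellFormed ∧ α.lang = L

/-- The Parikh vector of a word. -/
def parikhVector {A : Type*} [DecidableEq A] (w : List A) : A → ℕ := fun a => w.count a

/-- The set of vectors represented by a language. -/
def parikhImage {A : Type*} [DecidableEq A] (L : Language A) : Set (A → ℕ) :=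
  {v | ∃ w ∈ L, parikhVector w = v}

/-- An accepting P/T system with places `P`, transitions `T` (all arc weights are `1` and all
capacities are infinite), whose input places are the places `inp a`, one for each symbol `a`. -/
structure AcceptingPT (A : Type*) (P T : Type) where
  /-- the input set of a transition -/
  pre : T → Set P
  /-- the output set of a transition -/
  post : T → Set P
  pre_nonempty : ∀ t, (pre t).Nonempty
  post_nonempty : ∀ t, (post t).Nonempty
  /-- the input places -/
  inp : A ↪ P
  /-- the initial place -/
  pinit : P
  /-- the final place -/
  pfin : P
  pinit_work : pinit ∉ Set.range inp
  pfin_work : pfin ∉ Set.range inp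

namespace AcceptingPT

variable {A : Type*} {P T : Type}

/-- Transition `t` can fire in configuration `C`. -/
def Enabled (N : AcceptingPT A P T) (C : P → ℕ) (t : T) : Prop :=
  ∀ p ∈ N.pre t, 0 < C p

/-- Firing `t` leads from `C` to `D`: one token is taken from each place of the input set, and
one token is put into each place of the output set. -/
def Fires (N : AcceptingPT A P T) (C : P → ℕ) (t : T) (D : P → ℕ) : Prop :=
  N.Enabled C t ∧
    ∀ p, D p + (N.pre t).indicator 1 p = C p + (N.post t).indicator 1 p

/-- An edge of the sequential configuration graph. -/
def Step (N : AcceptingPT A P T) (C D : P → ℕ) : Prop := ∃ t, N.Fires C t D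

/-- There is a (possibly empty) path from `C` to `D` in the sequential configuration graph. -/
def Reaches (N : AcceptingPT A P T) : (P → ℕ) → (P → ℕ) → Prop :=
  Relation.ReflTransGen N.Step

/-- No transition can fire in `C`. -/
def Dead (N : AcceptingPT A P T) (C : P → ℕ) : Prop := ∀ t, ¬ N.Enabled C t

/-- `C` is the initial configuration with input `v`: the input places hold `v`, the initial place
holds one token, and all other places are empty. -/
def IsInitial (N : AcceptingPT A P T) (v : A → ℕ) (C : P → ℕ) : Prop :=
  (∀ a, C (N.inp a) = v a) ∧ C N.pinit = 1 ∧
    ∀ p, p ∉ Set.range N.inp → p ≠ N.pinit → C p = 0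

/-- Acceptance of a vector: some final (dead) configuration `F` with a token in the final place is
reachable, and no other configuration on the paths to `F` has a token in the final place. -/
def Accepts (N : AcceptingPT A P T) (v : A → ℕ) : Prop :=
  ∃ C F, N.IsInitial v C ∧ N.Dead F ∧ 0 < F N.pfin ∧ N.Reaches C F ∧
    ∀ D, N.Reaches C D → N.Reaches D F → D ≠ F → ¬ 0 < D N.pfin

/-- The set of vectors accepted by the system. -/
def acceptedVectors (N : AcceptingPT A P T) : Set (A → ℕ) := {v | N.Accepts v}

/-- The net is composed of joins (two input places, one output place, all three distinct), and
each transition takes an input place and a work place to a work place. -/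
def IsJSystem (N : AcceptingPT A P T) : Prop :=
  ∀ t, ∃ (a : A) (w w' : P), w ∉ Set.range N.inp ∧ w' ∉ Set.range N.inp ∧ w ≠ w' ∧
    N.pre t = {N.inp a, w} ∧ N.post t = {w'}

end AcceptingPT

/-- `S` is the set of vectors accepted by some finite J P/T system. -/
def AcceptedByJSystem {A : Type*} (S : Set (A → ℕ)) : Prop :=
  ∃ (P T : Type) (_ : Finite P) (_ : Finite T) (N : AcceptingPT A P T),
    N.IsJSystem ∧ N.acceptedVectors = S

/-- `S` is the set of Parikh vectors of some J language. -/
def RepresentedByJLanguage {A : Type*} [DecidableEq A] (S : Set (A → ℕ)) : Prop :=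
  ∃ L : Language A, IsJLanguage L ∧ parikhImage L = S

/-! Both formalisms describe the semilinear sets, up to the zero vector. Parikh images turn
concatenation into a commutative sum. So the factors of an exponentiation that share a variable can
be merged into one, after which the variables range independently
(`JExponent.isMulSemilinear_iUnion_prod_pow`). Conversely, union, concatenation and closure build
every nonempty semilinear set from letters. In a J P/T system exactly one token stays in the work
places, so the net is a finite automaton reading its input as a multiset. Kleene's argument
(`VectorPathIn.setOf_insert`) makes its path vectors semilinear; stopping at the first visit to the
final place costs a set difference (`isSemilinearSet_firstVisitVectors`). Conversely, an automaton
storing the part of a base or period still to be read accepts a given semilinear set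
(`IsSemilinearSet.acceptedByJSystem`). Zero is special because a system accepting it starts in its
final place, and so accepts only inputs on which it is dead at once. -/

open scoped Pointwise

/-! ### Parikh images of J languages and semilinear sets -/

section Parikh

variable {A : Type*} [DecidableEq A]

theorem parikhVector_append (u v : List A) :
    parikhVector (u ++ v) = parikhVector u + parikhVector v := by
  ext a; simp [parikhVector]

theorem parikhVector_singleton (a : A) : parikhVector [a] = Pi.single a 1 := by
  ext b
  by_cases h : a = b
  · subst h; simp [parikhVector]
  · simp [parikhVector, h, Ne.symm h]

theorem parikhImage_one : parikhImage (1 : Language A) = {0} := by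
  ext v
  simp only [parikhImage, Language.mem_one, exists_eq_left, Set.mem_ofPred_eq,
    Set.mem_singleton_iff]
  exact eq_comm

theorem parikhImage_add (L M : Language A) :
    parikhImage (L + M) = parikhImage L ∪ parikhImage M := by
  ext v
  simp only [parikhImage, Language.mem_add, or_and_right, exists_or, Set.mem_union,
    Set.mem_ofPred_eq]

theorem parikhImage_mul (L M : Language A) :
    parikhImage (L * M) = parikhImage L + parikhImage M := by
  ext v
  simp only [parikhImage, Language.mem_mul, Set.mem_add, Set.mem_ofPred_eq]
  constructor
  · rintro ⟨_, ⟨x, hx, y, hy, rfl⟩, rfl⟩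
    exact ⟨_, ⟨x, hx, rfl⟩, _, ⟨y, hy, rfl⟩, (parikhVector_append x y).symm⟩
  · rintro ⟨_, ⟨x, hx, rfl⟩, _, ⟨y, hy, rfl⟩, rfl⟩
    exact ⟨_, ⟨x, hx, y, hy, rfl⟩, parikhVector_append x y⟩

theorem parikhImage_singleton (a : A) :
    parikhImage ({[a]} : Language A) = {Pi.single a 1} := by
  ext v
  constructor
  · rintro ⟨w, rfl, rfl⟩
    exact parikhVector_singleton a
  · rintro rfl
    exact ⟨[a], rfl, parikhVector_singleton a⟩

/-- The commutative image of a language, as a monoid homomorphism. -/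
def parikhHom : Language A →* Set (Multiplicative (A → ℕ)) where
  toFun L := Multiplicative.toAdd ⁻¹' parikhImage L
  map_one' := by rw [parikhImage_one]; rfl
  map_mul' L M := by rw [parikhImage_mul]; rfl

theorem Set.iUnion_pow_eq_closure {M : Type*} [Monoid M] (s : Set M) :
    ⋃ n : ℕ, s ^ n = (Submonoid.closure s : Set M) := by
  apply Set.Subset.antisymm
  · refine Set.iUnion_subset fun n => ?_
    induction n with
    | zero => simp
    | succ n ih =>
      rw [pow_succ]
      rintro _ ⟨x, hx, y, hy, rfl⟩
      exact mul_mem (ih hx) (Submonoid.subset_closure hy)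
  · intro x hx
    induction hx using Submonoid.closure_induction with
    | mem x hx => exact Set.mem_iUnion.2 ⟨1, by simpa using hx⟩
    | one => exact Set.mem_iUnion.2 ⟨0, by simp⟩
    | mul x y _ _ hx hy =>
      obtain ⟨m, hm⟩ := Set.mem_iUnion.1 hx
      obtain ⟨n, hn⟩ := Set.mem_iUnion.1 hy
      exact Set.mem_iUnion.2 ⟨m + n, by rw [pow_add]; exact Set.mul_mem_mul hm hn⟩

theorem Set.iUnion_pow_pnat {M : Type*} [Monoid M] (s : Set M) :
    ⋃ n : ℕ+, s ^ (n : ℕ) = s * (Submonoid.closure s : Set M) := by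
  rw [← Set.iUnion_pow_eq_closure, Set.mul_iUnion]
  ext x
  simp only [Set.mem_iUnion, ← pow_succ']
  exact ⟨fun ⟨n, h⟩ => ⟨n.natPred, by simpa using h⟩, fun ⟨n, h⟩ => ⟨n.succPNat, by simpa using h⟩⟩

theorem toAdd_preimage_closure {M : Type*} [AddMonoid M] (s : Set M) :
    (Submonoid.closure (Multiplicative.toAdd ⁻¹' s) : Set (Multiplicative M)) =
      Multiplicative.toAdd ⁻¹' (AddSubmonoid.closure s : Set M) := by
  rw [← AddSubmonoid.toSubmonoid_closure]
  rfl

theorem parikhImage_kstar (L : Language A) :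
    parikhImage L∗ = (AddSubmonoid.closure (parikhImage L) : Set (A → ℕ)) := by
  have h : parikhHom L∗ = Multiplicative.toAdd ⁻¹'
      (AddSubmonoid.closure (parikhImage L) : Set (A → ℕ)) := by
    rw [← toAdd_preimage_closure]
    change _ = (Submonoid.closure (parikhHom L) : Set (Multiplicative (A → ℕ)))
    rw [← Set.iUnion_pow_eq_closure]
    simp_rw [← map_pow]
    rw [Language.kstar_eq_iSup_pow]
    ext v
    simp only [parikhHom, parikhImage, MonoidHom.coe_mk, OneHom.coe_mk, Set.mem_preimage,
      Set.mem_ofPred_eq, Set.mem_iUnion, Language.mem_iSup]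
    tauto
  exact h

/-- Semilinearity in multiplicative notation. -/
def IsMulSemilinear {M : Type*} [AddCommMonoid M] (s : Set (Multiplicative M)) : Prop :=
  IsSemilinearSet (Multiplicative.ofAdd ⁻¹' s)

namespace IsMulSemilinear

variable {M : Type*} [AddCommMonoid M] {s t : Set (Multiplicative M)}

theorem one : IsMulSemilinear (1 : Set (Multiplicative M)) :=
  IsSemilinearSet.singleton 0

theorem mul (hs : IsMulSemilinear s) (ht : IsMulSemilinear t) : IsMulSemilinear (s * t) :=
  IsSemilinearSet.add hs ht

theorem pow (hs : IsMulSemilinear s) (n : ℕ) : IsMulSemilinear (s ^ n) := by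
  induction n with
  | zero => rw [pow_zero]; exact one
  | succ n ih => rw [pow_succ]; exact ih.mul hs

theorem iUnion_pow_pnat (hs : IsMulSemilinear s) :
    IsMulSemilinear (⋃ n : ℕ+, s ^ (n : ℕ)) := by
  rw [Set.iUnion_pow_pnat]
  refine hs.mul ?_
  have := IsSemilinearSet.closure hs
  rw [IsMulSemilinear]
  convert this using 1
  exact congrArg (Multiplicative.ofAdd ⁻¹' ·)
    (toAdd_preimage_closure (Multiplicative.ofAdd ⁻¹' s))

/-- Distinct variables are chosen independently, so the union distributes over the product and
leaves one factor `⋃ n, Z x ^ n` for each variable. -/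
theorem iUnion_mul_prod_pow (V : Finset ℕ) {Z : ℕ → Set (Multiplicative M)}
    (hZ : ∀ x, IsMulSemilinear (Z x)) (hs : IsMulSemilinear s) :
    IsMulSemilinear (⋃ ν : ℕ → ℕ+, s * ∏ x ∈ V, Z x ^ (ν x : ℕ)) := by
  induction V using Finset.induction_on with
  | empty =>
    simp_rw [Finset.prod_empty, mul_one]
    rwa [Set.iUnion_const]
  | insert x V hx ih =>
    convert ih.mul (hZ x).iUnion_pow_pnat using 1
    rw [Set.iUnion_mul]
    simp_rw [Set.mul_iUnion, Finset.prod_insert hx]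
    apply Set.Subset.antisymm
    · refine Set.iUnion_subset fun ν => Set.subset_iUnion₂_of_subset ν (ν x) ?_
      rw [mul_assoc, mul_comm (Z x ^ _)]
    · refine Set.iUnion₂_subset fun ν n =>
        Set.subset_iUnion_of_subset (Function.update ν x n) ?_
      rw [Function.update_self, mul_assoc, mul_comm (Z x ^ _)]
      rw [Finset.prod_congr rfl fun y hy => ?_]
      rw [Function.update_of_ne]
      rintro rfl
      exact hx hy

end IsMulSemilinear

/-- By commutativity `Y ^ n * Y' ^ n = (Y * Y') ^ n`, so each variable can be made to occur once;
constant powers go into `s`. -/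
theorem JExponent.isMulSemilinear_iUnion_prod_pow {M : Type*} [AddCommMonoid M] {ι : Type*}
    (I : Finset ι) (e : ι → JExponent) {Y : ι → Set (Multiplicative M)}
    (hY : ∀ i, IsMulSemilinear (Y i)) :
    IsMulSemilinear (⋃ ν : ℕ → ℕ+, ∏ i ∈ I, Y i ^ (e i).val ν) := by
  classical
  suffices h : ∃ (s : Set (Multiplicative M)) (V : Finset ℕ) (Z : ℕ → Set (Multiplicative M)),
      IsMulSemilinear s ∧ (∀ x, IsMulSemilinear (Z x)) ∧
      ∀ ν : ℕ → ℕ+, ∏ i ∈ I, Y i ^ (e i).val ν = s * ∏ x ∈ V, Z x ^ (ν x : ℕ) by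
    obtain ⟨s, V, Z, hs, hZ, h⟩ := h
    simp_rw [h]
    exact IsMulSemilinear.iUnion_mul_prod_pow V hZ hs
  induction I using Finset.induction_on with
  | empty => exact ⟨1, ∅, fun _ => 1, .one, fun _ => .one, by simp⟩
  | insert i I hi ih =>
    obtain ⟨s, V, Z, hs, hZ, h⟩ := ih
    simp_rw [Finset.prod_insert hi, h]
    cases he : e i with
    | const n =>
      exact ⟨Y i ^ (n : ℕ) * s, V, Z, ((hY i).pow _).mul hs, hZ, fun ν => by
        rw [mul_assoc]; rfl⟩
    | var x =>
      -- Values of `Z` outside `V` are arbitrary and are reset to `1`, which treats new and old `x`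
      -- alike.
      refine ⟨s, insert x V, fun y => (if y ∈ V then Z y else 1) * if y = x then Y i else 1,
        hs, fun y => ?_, fun ν => ?_⟩
      · refine .mul ?_ ?_
        · split_ifs
          exacts [hZ y, .one]
        · split_ifs
          exacts [hY i, .one]
      · simp_rw [mul_pow, Finset.prod_mul_distrib, ite_pow, one_pow]
        rw [Finset.prod_ite_eq' (insert x V) x, if_pos (Finset.mem_insert_self x V),
          ← Finset.prod_filter, mul_left_comm, mul_comm (Y i ^ _)]
        have : (insert x V).filter (· ∈ V) = V := by
          ext y
          simp
        rw [this]
        rfl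

theorem JExpr.isSemilinearSet_parikhImage_lang (α : JExpr A) :
    IsSemilinearSet (parikhImage α.lang) := by
  induction α with
  | eps => rw [lang, parikhImage_one]; exact .singleton 0
  | sym a => rw [lang, parikhImage_singleton]; exact .singleton _
  | union α β hα hβ => rw [lang, parikhImage_add]; exact hα.union hβ
  | concat α β hα hβ => rw [lang, parikhImage_mul]; exact hα.add hβ
  | plus α hα => rw [lang, parikhImage_mul, parikhImage_kstar]; exact hα.add hα.closure
  | expo k β n ih =>
    have h := JExponent.isMulSemilinear_iUnion_prod_pow Finset.univ n
      (Y := fun j => parikhHom (β j).lang) ih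
    unfold IsMulSemilinear at h
    convert h using 1
    have key (ν : ℕ → ℕ+) : ∏ j, parikhHom (β j).lang ^ (n j).val ν =
        parikhHom (List.ofFn fun j => (β j).lang ^ (n j).val ν).prod := by
      rw [map_list_prod, List.map_ofFn, List.prod_ofFn]
      simp
    simp_rw [key]
    ext v
    simp only [lang, parikhHom, parikhImage, MonoidHom.coe_mk, OneHom.coe_mk, Set.mem_preimage,
      Set.mem_ofPred_eq, Set.mem_iUnion]
    constructor
    · rintro ⟨w, ⟨ν, h⟩, rfl⟩
      exact ⟨ν, w, h, rfl⟩
    · rintro ⟨ν, w, h, hv⟩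
      exact ⟨w, ⟨ν, h⟩, hv⟩

theorem representedByJLanguage_iff {S : Set (A → ℕ)} :
    RepresentedByJLanguage S ↔ ∃ α : JExpr A, α.WellFormed ∧ parikhImage α.lang = S := by
  simp [RepresentedByJLanguage, IsJLanguage]

theorem RepresentedByJLanguage.isSemilinearSet {S : Set (A → ℕ)}
    (h : RepresentedByJLanguage S) : IsSemilinearSet S := by
  obtain ⟨α, -, rfl⟩ := representedByJLanguage_iff.1 h
  exact α.isSemilinearSet_parikhImage_lang

theorem representedByJLanguage_zero : RepresentedByJLanguage ({0} : Set (A → ℕ)) :=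
  representedByJLanguage_iff.2 ⟨.eps, trivial, parikhImage_one⟩

theorem representedByJLanguage_single (a : A) :
    RepresentedByJLanguage ({Pi.single a 1} : Set (A → ℕ)) :=
  representedByJLanguage_iff.2 ⟨.sym a, trivial, parikhImage_singleton a⟩

namespace RepresentedByJLanguage

variable {S T : Set (A → ℕ)}

theorem union (hS : RepresentedByJLanguage S) (hT : RepresentedByJLanguage T) :
    RepresentedByJLanguage (S ∪ T) := by
  obtain ⟨α, hα, rfl⟩ := representedByJLanguage_iff.1 hS
  obtain ⟨β, hβ, rfl⟩ := representedByJLanguage_iff.1 hT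
  exact representedByJLanguage_iff.2 ⟨.union α β, ⟨hα, hβ⟩, parikhImage_add _ _⟩

/-- Concatenation with `eps` is not well formed, but there the sum is just the other summand. -/
theorem add (hS : RepresentedByJLanguage S) (hT : RepresentedByJLanguage T) :
    RepresentedByJLanguage (S + T) := by
  obtain ⟨α, hα, rfl⟩ := representedByJLanguage_iff.1 hS
  obtain ⟨β, hβ, rfl⟩ := representedByJLanguage_iff.1 hT
  by_cases h : α = .eps
  · subst h
    rwa [JExpr.lang, parikhImage_one, Set.singleton_zero, zero_add]
  by_cases h' : β = .eps
  · subst h'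
    rwa [JExpr.lang, parikhImage_one, Set.singleton_zero, add_zero]
  exact representedByJLanguage_iff.2 ⟨.concat α β, ⟨hα, hβ, h, h'⟩, parikhImage_mul _ _⟩

theorem closure (hS : RepresentedByJLanguage S) :
    RepresentedByJLanguage (AddSubmonoid.closure S : Set (A → ℕ)) := by
  obtain ⟨α, hα, rfl⟩ := representedByJLanguage_iff.1 hS
  by_cases h : α = .eps
  · subst h
    rw [JExpr.lang, parikhImage_one, AddSubmonoid.closure_singleton_zero]
    exact representedByJLanguage_zero
  · have hp := representedByJLanguage_iff.2 ⟨.plus α, ⟨hα, h⟩, rfl⟩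
    convert representedByJLanguage_zero.union hp
    rw [JExpr.lang, ← parikhImage_one, ← parikhImage_add, Language.one_add_self_mul_kstar_eq_kstar,
      parikhImage_kstar]

end RepresentedByJLanguage

theorem representedByJLanguage_singleton [Finite A] (v : A → ℕ) :
    RepresentedByJLanguage ({v} : Set (A → ℕ)) := by
  have := Fintype.ofFinite A
  let H : AddSubmonoid (A → ℕ) :=
    { carrier := {v | RepresentedByJLanguage ({v} : Set (A → ℕ))}
      zero_mem' := representedByJLanguage_zero
      add_mem' := fun {u v} hu hv => by simpa using RepresentedByJLanguage.add hu hv }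
  have h : ∑ a, v a • (Pi.single a 1 : A → ℕ) ∈ H :=
    sum_mem fun a _ => nsmul_mem (representedByJLanguage_single a : Pi.single a 1 ∈ H) _
  have e : ∑ a, v a • (Pi.single a 1 : A → ℕ) = v := by
    ext b
    simp [Finset.sum_apply, Pi.single_apply]
  rw [e] at h
  exact h

/-- The submonoid generated by the periods is the sum of those generated by the single periods. -/
theorem IsLinearSet.representedByJLanguage [Finite A] {S : Set (A → ℕ)} (hS : IsLinearSet S) :
    RepresentedByJLanguage S := by
  obtain ⟨a, t, ht, rfl⟩ := hS
  rw [← Set.singleton_vadd, vadd_eq_add]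
  refine (representedByJLanguage_singleton a).add ?_
  induction t, ht using Set.Finite.induction_on with
  | empty => simpa using representedByJLanguage_zero
  | @insert x t _ _ ih =>
    rw [Set.insert_eq, AddSubmonoid.closure_union, AddSubmonoid.coe_sup]
    exact (representedByJLanguage_singleton x).closure.add ih

theorem IsSemilinearSet.representedByJLanguage [Finite A] {S : Set (A → ℕ)}
    (hS : IsSemilinearSet S) (hne : S.Nonempty) : RepresentedByJLanguage S := by
  obtain ⟨C, hC, hlin, rfl⟩ := hS
  induction C, hC using Set.Finite.induction_on with
  | empty => simp at hne
  | @insert s C _ _ ih =>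
    rw [Set.sUnion_insert]
    have hs := (hlin s (by simp)).representedByJLanguage
    -- An empty remainder must be dropped, since no J expression denotes the empty language.
    rcases (⋃₀ C).eq_empty_or_nonempty with h | h
    · rwa [h, Set.union_empty]
    · exact hs.union (ih (fun t ht => hlin t (by simp [ht])) h)

end Parikh

/-! ### Path vectors of finite automata -/

/-- `VectorPath E p v q`: in the automaton with edges `E` there is a path from `p` to `q` whose
label has the Parikh vector `v`. -/
inductive VectorPath {A Q : Type*} [DecidableEq A] (E : Q → A → Q → Prop) : Q → (A → ℕ) → Q → Prop
  | refl (p : Q) : VectorPath E p 0 p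
  | cons {p : Q} {a : A} {q : Q} {v : A → ℕ} {r : Q} :
      E p a q → VectorPath E q v r → VectorPath E p (Pi.single a 1 + v) r

/-- `VectorPathIn E K p v q`: there is a nonempty path from `p` to `q` with label of Parikh
vector `v` all of whose inner states lie in `K`. -/
inductive VectorPathIn {A Q : Type*} [DecidableEq A] (E : Q → A → Q → Prop) (K : Set Q) :
    Q → (A → ℕ) → Q → Prop
  | edge {p : Q} {a : A} {q : Q} : E p a q → VectorPathIn E K p (Pi.single a 1) q
  | cons {p : Q} {a : A} {q : Q} {v : A → ℕ} {r : Q} :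
      E p a q → q ∈ K → VectorPathIn E K q v r → VectorPathIn E K p (Pi.single a 1 + v) r

section VectorPath

variable {A Q : Type*} [DecidableEq A] {E : Q → A → Q → Prop} {K L : Set Q} {p q r : Q}
  {u v : A → ℕ}

theorem VectorPath.trans (h : VectorPath E p u q) (h' : VectorPath E q v r) :
    VectorPath E p (u + v) r := by
  induction h with
  | refl => rwa [zero_add]
  | cons e _ ih => rw [add_assoc]; exact .cons e (ih h')

theorem VectorPath.single {a : A} (h : E p a q) : VectorPath E p (Pi.single a 1) q := by
  simpa using VectorPath.cons h (.refl q)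

theorem eq_single_add_sub {a : A} (h : v a ≠ 0) : v = Pi.single a 1 + (v - Pi.single a 1) := by
  ext b
  by_cases hb : b = a
  · subst hb
    simp
    omega
  · simp [hb]

namespace VectorPathIn

theorem mono (hKL : K ⊆ L) (h : VectorPathIn E K p v q) : VectorPathIn E L p v q := by
  induction h with
  | edge e => exact .edge e
  | cons e hq _ ih => exact .cons e (hKL hq) ih

theorem trans (h : VectorPathIn E K p u q) (hq : q ∈ K) (h' : VectorPathIn E K q v r) :
    VectorPathIn E K p (u + v) r := by
  induction h with
  | edge e => exact .cons e hq h'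
  | cons e hq' _ ih => rw [add_assoc]; exact .cons e hq' (ih hq h')

/-- Kleene's recursion: cut a path at its visits to `k`; the loops between consecutive visits
contribute a submonoid. -/
theorem setOf_insert (E : Q → A → Q → Prop) (K : Set Q) (k p q : Q) :
    {v | VectorPathIn E (insert k K) p v q} = {v | VectorPathIn E K p v q} ∪
      ({v | VectorPathIn E K p v k} +
        (AddSubmonoid.closure {v | VectorPathIn E K k v k} : Set (A → ℕ)) +
        {v | VectorPathIn E K k v q}) := by
  apply Set.Subset.antisymm
  · intro v h
    induction h with
    | edge e => exact Or.inl (.edge e)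
    | @cons p a p' v q e hp' _ ih =>
      rcases hp' with rfl | hp'
      · right
        rcases ih with ih | ⟨_, ⟨x, hx, y, hy, rfl⟩, z, hz, rfl⟩
        · exact ⟨_, ⟨_, .edge e, 0, zero_mem _, rfl⟩, v, ih, by simp⟩
        · exact ⟨_, ⟨_, .edge e, x + y, add_mem (AddSubmonoid.subset_closure hx) hy, rfl⟩, z, hz,
            by simp [add_assoc]⟩
      · rcases ih with ih | ⟨_, ⟨x, hx, y, hy, rfl⟩, z, hz, rfl⟩
        · exact Or.inl (.cons e hp' ih)
        · exact Or.inr ⟨_, ⟨_, .cons e hp' hx, y, hy, rfl⟩, z, hz, by simp [add_assoc]⟩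
  · rintro v (h | ⟨_, ⟨x, hx, y, hy, rfl⟩, z, hz, rfl⟩)
    · exact mono (Set.subset_insert k K) h
    · have hk : k ∈ insert k K := Set.mem_insert k K
      -- Loops are appended to a prefix because the zero of the closure need not be the vector of a
      -- nonempty path.
      have key : ∀ w, VectorPathIn E (insert k K) p w k →
          VectorPathIn E (insert k K) p (w + y) k := by
        clear hx hz
        induction hy using AddSubmonoid.closure_induction with
        | mem y hy => exact fun w hw => hw.trans hk (mono (Set.subset_insert k K) hy)
        | zero => intro w hw; rwa [add_zero]
        | add a b _ _ ha hb => intro w hw; rw [← add_assoc]; exact hb _ (ha w hw)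
      exact (key x (mono (Set.subset_insert k K) hx)).trans hk (mono (Set.subset_insert k K) hz)

theorem isSemilinearSet [Finite A] (E : Q → A → Q → Prop) (hK : K.Finite) (p q : Q) :
    IsSemilinearSet {v | VectorPathIn E K p v q} := by
  induction K, hK using Set.Finite.induction_on generalizing p q with
  | empty =>
    refine .of_finite ((Set.finite_range fun a : A => (Pi.single a 1 : A → ℕ)).subset ?_)
    rintro _ (@⟨_, a, _, e⟩ | ⟨_, h, _⟩)
    · exact ⟨a, rfl⟩
    · exact h.elim
  | @insert k K _ _ ih =>
    rw [setOf_insert]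
    exact (ih p q).union (((ih p k).add (ih k k).closure).add (ih k q))

end VectorPathIn

theorem vectorPath_iff :
    VectorPath E p v q ↔ p = q ∧ v = 0 ∨ VectorPathIn E Set.univ p v q := by
  constructor
  · intro h
    induction h with
    | refl p => exact .inl ⟨rfl, rfl⟩
    | cons e _ ih =>
      rcases ih with ⟨rfl, rfl⟩ | ih
      · rw [add_zero]; exact .inr (.edge e)
      · exact .inr (.cons e trivial ih)
  · rintro (⟨rfl, rfl⟩ | h)
    · exact .refl p
    · induction h with
      | edge e => exact .single e
      | cons e _ _ ih => exact .cons e ih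

theorem VectorPath.isSemilinearSet [Finite A] [Finite Q] (E : Q → A → Q → Prop) (p q : Q) :
    IsSemilinearSet {v | VectorPath E p v q} := by
  simp_rw [vectorPath_iff]
  refine IsSemilinearSet.union (.of_finite ((Set.finite_singleton 0).subset ?_))
    (VectorPathIn.isSemilinearSet E Set.finite_univ p q)
  rintro v ⟨-, rfl⟩
  rfl

/-- These are the path vectors of a one-state automaton with a loop for each letter outside `B`. -/
theorem isSemilinearSet_setOf_eq_zero_on [Finite A] (B : Set A) :
    IsSemilinearSet {v : A → ℕ | ∀ a ∈ B, v a = 0} := by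
  have h := (VectorPath.isSemilinearSet (fun (_ : Unit) (a : A) (_ : Unit) => a ∉ B) () ())
  convert h using 1
  ext v
  constructor
  · intro hv
    have := Fintype.ofFinite A
    let H : AddSubmonoid (A → ℕ) :=
      { carrier := {v | VectorPath (fun (_ : Unit) (a : A) (_ : Unit) => a ∉ B) () v ()}
        zero_mem' := .refl ()
        add_mem' := .trans }
    have h : ∑ a, v a • (Pi.single a 1 : A → ℕ) ∈ H := sum_mem fun a _ => by
      by_cases ha : a ∈ B
      · rw [hv a ha, zero_smul]; exact zero_mem _
      · exact nsmul_mem (show Pi.single a 1 ∈ H from .single ha) _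
    have e : ∑ a, v a • (Pi.single a 1 : A → ℕ) = v := by
      ext b
      simp [Finset.sum_apply, Pi.single_apply]
    rwa [e] at h
  · suffices h : ∀ x y, VectorPath (fun (_ : Unit) (a : A) (_ : Unit) => a ∉ B) x v y →
        ∀ a ∈ B, v a = 0 from h () ()
    intro x y hv
    induction hv with
    | refl => simp
    | @cons p a q v r e _ ih =>
      intro b hb
      have : b ≠ a := by rintro rfl; exact e hb
      simp [this, ih b hb]

end VectorPath

/-- The vectors accepted by an automaton that starts in `i` and stops on its first visit to `f`,
leaving an input on which it cannot move on. -/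
def firstVisitVectors {A Q : Type*} [DecidableEq A] (E : Q → A → Q → Prop) (i f : Q) :
    Set (A → ℕ) :=
  {v | ∃ u r, v = u + r ∧ VectorPath E i u f ∧ (∀ a, r a ≠ 0 → ∀ q, ¬ E f a q) ∧
    ∀ s t, u = s + t → VectorPath E i s f → VectorPath E f t f → t = 0}

/-- Acceptance forbids an earlier visit on every path with the same vector, so the condition
concerns `u` alone: remove the sums of a path vector from `i` to `f` and a nonzero one from `f` to
`f`. The unread rest vanishes on the letters readable in `f`. -/
theorem isSemilinearSet_firstVisitVectors {A Q : Type*} [DecidableEq A] [Finite A] [Finite Q]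
    (E : Q → A → Q → Prop) (i f : Q) : IsSemilinearSet (firstVisitVectors E i f) := by
  have h := (((VectorPath.isSemilinearSet E i f).sdiff ((VectorPath.isSemilinearSet E i f).add
    ((VectorPath.isSemilinearSet E f f).sdiff (.singleton 0)))).add
    (isSemilinearSet_setOf_eq_zero_on {a | ∃ q, E f a q}))
  convert h using 1
  ext v
  constructor
  · rintro ⟨u, r, rfl, hu, hr, hf⟩
    refine ⟨u, ⟨hu, ?_⟩, r, ?_, rfl⟩
    · rintro ⟨s, hs, t, ⟨ht, ht0⟩, rfl⟩
      exact ht0 (hf s t rfl hs ht)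
    · rintro a ⟨q, hq⟩
      by_contra h0
      exact hr a h0 q hq
  · rintro ⟨u, ⟨hu, hf⟩, r, hr, rfl⟩
    refine ⟨u, r, rfl, hu, fun a ha q hq => ha (hr a ⟨q, hq⟩), fun s t hst hs ht => ?_⟩
    by_contra h0
    exact hf ⟨s, hs, t, ⟨ht, h0⟩, hst.symm⟩

/-! ### J P/T systems as automata -/

namespace AcceptingPT

variable {A : Type*} {P T : Type} (N : AcceptingPT A P T)

open Classical in
/-- The configuration with input `v` and a single token in the work places, in `p`. -/
noncomputable def config (v : A → ℕ) (p : P) : P → ℕ :=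
  Function.extend N.inp v 0 + Pi.single p 1

/-- The edges of the automaton of the work places. -/
def Edge (p : P) (a : A) (q : P) : Prop :=
  p ∉ Set.range N.inp ∧ q ∉ Set.range N.inp ∧ ∃ t, N.pre t = {N.inp a, p} ∧ N.post t = {q}

variable {N} {v : A → ℕ} {p : P}

theorem config_inp (hp : p ∉ Set.range N.inp) (a : A) : N.config v p (N.inp a) = v a := by
  have : N.inp a ≠ p := fun h => hp ⟨a, h⟩
  simp [config, N.inp.injective.extend_apply, this]

theorem config_self (hp : p ∉ Set.range N.inp) : N.config v p p = 1 := by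
  have : ¬ ∃ a, N.inp a = p := hp
  simp [config, Function.extend_apply' _ _ _ this]

theorem config_of_ne {q : P} (hq : q ∉ Set.range N.inp) (h : q ≠ p) : N.config v p q = 0 := by
  have : ¬ ∃ a, N.inp a = q := hq
  simp [config, Function.extend_apply' _ _ _ this, h]

theorem config_pos_iff {q : P} (hq : q ∉ Set.range N.inp) : 0 < N.config v p q ↔ q = p := by
  constructor
  · intro h
    by_contra h'
    exact h.ne' (config_of_ne hq h')
  · rintro rfl
    rw [config_self hq]
    exact one_pos

theorem config_injective {v' : A → ℕ} {p' : P} (hp : p ∉ Set.range N.inp)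
    (hp' : p' ∉ Set.range N.inp) (h : N.config v p = N.config v' p') : v = v' ∧ p = p' := by
  refine ⟨funext fun a => ?_, ?_⟩
  · rw [← config_inp (N := N) (v := v) hp, h, config_inp hp']
  · rw [← config_pos_iff (N := N) (v := v') hp, ← h, config_self hp]
    exact one_pos

theorem isInitial_iff {C : P → ℕ} : N.IsInitial v C ↔ C = N.config v N.pinit := by
  constructor
  · rintro ⟨h₁, h₂, h₃⟩
    ext x
    by_cases hx : x ∈ Set.range N.inp
    · obtain ⟨a, rfl⟩ := hx
      rw [h₁, config_inp N.pinit_work]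
    · by_cases hx' : x = N.pinit
      · rw [hx', h₂, config_self N.pinit_work]
      · rw [h₃ x hx hx', config_of_ne hx hx']
  · rintro rfl
    exact ⟨config_inp N.pinit_work, config_self N.pinit_work, fun x hx hx' => config_of_ne hx hx'⟩

theorem enabled_config_iff {t : T} {a : A} {w : P} (hp : p ∉ Set.range N.inp)
    (hw : w ∉ Set.range N.inp) (ht : N.pre t = {N.inp a, w}) :
    N.Enabled (N.config v p) t ↔ v a ≠ 0 ∧ w = p := by
  simp only [Enabled, ht, Set.mem_insert_iff, Set.mem_singleton_iff, forall_eq_or_imp, forall_eq,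
    config_inp hp, config_pos_iff hw]
  rw [Nat.pos_iff_ne_zero]

theorem dead_config_iff (hN : N.IsJSystem) (hp : p ∉ Set.range N.inp) :
    N.Dead (N.config v p) ↔ ∀ a, v a ≠ 0 → ∀ q, ¬ N.Edge p a q := by
  constructor
  · rintro h a ha q ⟨-, -, t, ht, -⟩
    exact h t ((enabled_config_iff hp hp ht).2 ⟨ha, rfl⟩)
  · intro h t ht
    obtain ⟨a, w, w', hw, hw', -, hpre, hpost⟩ := hN t
    obtain ⟨ha, rfl⟩ := (enabled_config_iff hp hw hpre).1 ht
    exact h a ha w' ⟨hw, hw', t, hpre, hpost⟩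

variable [DecidableEq A]

theorem config_single_add (a : A) {q : P} (hp : p ∉ Set.range N.inp) (x : P) :
    N.config v q x + ({N.inp a, p} : Set P).indicator 1 x =
      N.config (Pi.single a 1 + v) p x + ({q} : Set P).indicator 1 x := by
  classical
  have hap : N.inp a ≠ p := fun h => hp ⟨a, h⟩
  have h₁ : Function.extend N.inp (Pi.single a 1 + v) 0 x =
      (if x = N.inp a then 1 else 0) + Function.extend N.inp v 0 x := by
    by_cases hx : ∃ b, N.inp b = x
    · obtain ⟨b, rfl⟩ := hx
      simp [N.inp.injective.extend_apply, Pi.single_apply]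
    · have : x ≠ N.inp a := fun h => hx ⟨a, h.symm⟩
      simp [Function.extend_apply' _ _ _ hx, this]
  have h₂ : ({N.inp a, p} : Set P).indicator 1 x =
      (if x = N.inp a then 1 else 0) + (if x = p then 1 else 0 : ℕ) := by
    by_cases hx : x = N.inp a
    · subst hx; simp [hap]
    · simp [Set.indicator_apply, hx]
  have h₃ : ({q} : Set P).indicator 1 x = (if x = q then 1 else 0 : ℕ) := by
    simp [Set.indicator_apply]
  simp only [config, Pi.add_apply, h₁, h₂, h₃, Pi.single_apply]
  ring

/-- A join consumes one letter and moves the only work token, so configurations of this shape are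
preserved. -/
theorem step_config_iff (hN : N.IsJSystem) (hp : p ∉ Set.range N.inp) {D : P → ℕ} :
    N.Step (N.config v p) D ↔
      ∃ a v' q, N.Edge p a q ∧ v = Pi.single a 1 + v' ∧ D = N.config v' q := by
  constructor
  · rintro ⟨t, ht, hD⟩
    obtain ⟨a, w, w', hw, hw', -, hpre, hpost⟩ := hN t
    obtain ⟨ha, rfl⟩ := (enabled_config_iff hp hw hpre).1 ht
    have hv := eq_single_add_sub ha
    refine ⟨a, v - Pi.single a 1, w', ⟨hw, hw', t, hpre, hpost⟩, hv, funext fun x => ?_⟩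
    have h₁ := hD x
    rw [hpre, hpost] at h₁
    have h₂ := config_single_add (v := v - Pi.single a 1) a (q := w') hp x
    rw [← hv] at h₂
    omega
  · rintro ⟨a, v', q, ⟨-, hq, t, hpre, hpost⟩, rfl, rfl⟩
    refine ⟨t, (enabled_config_iff hp hp hpre).2 ⟨by simp, rfl⟩, fun x => ?_⟩
    rw [hpre, hpost]
    exact config_single_add a hp x

theorem _root_.VectorPath.edge_work {u : A → ℕ} {q : P} (h : VectorPath N.Edge p u q)
    (hp : p ∉ Set.range N.inp) : q ∉ Set.range N.inp := by
  induction h with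
  | refl => exact hp
  | cons e _ ih => exact ih e.2.1

theorem reaches_config_iff (hN : N.IsJSystem) (hp : p ∉ Set.range N.inp) {D : P → ℕ} :
    N.Reaches (N.config v p) D ↔
      ∃ u v' q, VectorPath N.Edge p u q ∧ v = u + v' ∧ D = N.config v' q := by
  constructor
  · intro h
    generalize hC : N.config v p = C at h
    induction h using Relation.ReflTransGen.head_induction_on generalizing v p with
    | refl => exact ⟨0, v, p, .refl p, by simp, hC.symm⟩
    | head hs _ ih =>
      subst hC
      obtain ⟨a, v', q, e, rfl, rfl⟩ := (step_config_iff hN hp).1 hs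
      obtain ⟨u, v'', q', h, rfl, rfl⟩ := ih e.2.1 rfl
      exact ⟨_, v'', q', .cons e h, (add_assoc _ _ _).symm, rfl⟩
  · rintro ⟨u, v', q, h, rfl, rfl⟩
    induction h with
    | refl => rw [zero_add]; exact .refl
    | cons e _ ih =>
      rw [add_assoc]
      exact .head ((step_config_iff hN hp).2 ⟨_, _, _, e, rfl, rfl⟩) (ih e.2.1)

theorem acceptedVectors_eq_firstVisitVectors (hN : N.IsJSystem) :
    N.acceptedVectors = firstVisitVectors N.Edge N.pinit N.pfin := by
  ext v
  constructor
  · rintro ⟨C, F, hC, hdead, hfin, hreach, hfirst⟩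
    obtain rfl := isInitial_iff.1 hC
    obtain ⟨u, r, q, h, rfl, rfl⟩ := (reaches_config_iff hN N.pinit_work).1 hreach
    obtain rfl := (config_pos_iff N.pfin_work).1 hfin
    refine ⟨u, r, rfl, h, (dead_config_iff hN N.pfin_work).1 hdead, ?_⟩
    rintro s t rfl hs ht
    by_contra h0
    -- The configuration after reading `s` differs from the last one exactly when `t ≠ 0`.
    refine hfirst (N.config (t + r) N.pfin)
      ((reaches_config_iff hN N.pinit_work).2 ⟨s, t + r, _, hs, add_assoc _ _ _, rfl⟩)
      ((reaches_config_iff hN N.pfin_work).2 ⟨t, r, _, ht, rfl, rfl⟩) (fun h => h0 ?_)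
      ((config_pos_iff N.pfin_work).2 rfl)
    have := (config_injective N.pfin_work N.pfin_work h).1
    simpa using this
  · rintro ⟨u, r, rfl, h, hr, hfirst⟩
    refine ⟨_, N.config r N.pfin, isInitial_iff.2 rfl, (dead_config_iff hN N.pfin_work).2 hr,
      (config_pos_iff N.pfin_work).2 rfl,
      (reaches_config_iff hN N.pinit_work).2 ⟨u, r, _, h, rfl, rfl⟩, fun D hD hDF hne hpos => hne ?_⟩
    obtain ⟨s, v', q, hs, hv', rfl⟩ := (reaches_config_iff hN N.pinit_work).1 hD
    obtain rfl := (config_pos_iff N.pfin_work).1 hpos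
    obtain ⟨t, r', q', ht, rfl, hF⟩ := (reaches_config_iff hN N.pfin_work).1 hDF
    obtain ⟨rfl, rfl⟩ := config_injective N.pfin_work (ht.edge_work N.pfin_work) hF
    rw [← add_assoc] at hv'
    rw [hfirst s t (add_right_cancel hv') hs ht, zero_add]

end AcceptingPT

theorem AcceptedByJSystem.isSemilinearSet {A : Type*} [Finite A] {S : Set (A → ℕ)}
    (h : AcceptedByJSystem S) : IsSemilinearSet S := by
  classical
  obtain ⟨P, T, _, _, N, hN, rfl⟩ := h
  rw [AcceptingPT.acceptedVectors_eq_firstVisitVectors hN]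
  exact isSemilinearSet_firstVisitVectors _ _ _

/-! ### Systems for semilinear sets -/

section Synthesis

variable {A Q R : Type*} [DecidableEq A]

/-- The range of `φ` is closed under successors, so a path that starts there stays there. -/
theorem vectorPath_map_iff {E : Q → A → Q → Prop} {E' : R → A → R → Prop} {φ : Q → R}
    (hφ : φ.Injective) (h : ∀ p a x, E' (φ p) a x ↔ ∃ q, x = φ q ∧ E p a q) {p q : Q}
    {v : A → ℕ} : VectorPath E' (φ p) v (φ q) ↔ VectorPath E p v q := by
  constructor
  · intro hv
    generalize hx : φ p = x, hy : φ q = y at hv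
    induction hv generalizing p with
    | refl =>
      subst hy
      obtain rfl := hφ hx
      exact .refl p
    | cons e _ ih =>
      subst hx
      obtain ⟨r, rfl, hr⟩ := (h _ _ _).1 e
      exact .cons hr (ih rfl hy)
  · intro hv
    induction hv with
    | refl p => exact .refl _
    | cons e _ ih => exact .cons ((h _ _ _).2 ⟨_, rfl, e⟩) ih

theorem firstVisitVectors_map {E : Q → A → Q → Prop} {E' : R → A → R → Prop} {φ : Q → R}
    (hφ : φ.Injective) (h : ∀ p a x, E' (φ p) a x ↔ ∃ q, x = φ q ∧ E p a q) (i f : Q) :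
    firstVisitVectors E' (φ i) (φ f) = firstVisitVectors E i f := by
  have : ∀ a, (∀ x, ¬ E' (φ f) a x) ↔ ∀ q, ¬ E f a q := by
    intro a
    simp only [h]
    exact ⟨fun H q hq => H _ ⟨q, rfl, hq⟩, fun H _ ⟨q, _, hq⟩ => H q hq⟩
  simp only [firstVisitVectors, vectorPath_map_iff hφ h, this]

theorem acceptedByJSystem_firstVisitVectors [Finite A] [Finite Q] (E : Q → A → Q → Prop)
    (hE : ∀ p a q, E p a q → p ≠ q) (i f : Q) : AcceptedByJSystem (firstVisitVectors E i f) := by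
  obtain ⟨n, ⟨eA⟩⟩ := Finite.exists_equiv_fin A
  obtain ⟨m, ⟨eQ⟩⟩ := Finite.exists_equiv_fin Q
  -- Places must live in `Type`, hence the copies in `Fin`: input places on the left, states on the
  -- right.
  let φ : Q → Fin n ⊕ Fin m := fun q => Sum.inr (eQ q)
  have hφ : φ.Injective := Sum.inr_injective.comp eQ.injective
  let T : Type := {t : Fin m × Fin n × Fin m // E (eQ.symm t.1) (eA.symm t.2.1) (eQ.symm t.2.2)}
  have hwork : ∀ k : Fin m, (Sum.inr k : Fin n ⊕ Fin m) ∉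
      Set.range (eA.toEmbedding.trans Function.Embedding.inl) := by
    rintro k ⟨a, ha⟩
    cases ha
  let N : AcceptingPT A (Fin n ⊕ Fin m) T :=
    { pre := fun t => {Sum.inl t.1.2.1, Sum.inr t.1.1}
      post := fun t => {Sum.inr t.1.2.2}
      pre_nonempty := fun t => ⟨_, Or.inl rfl⟩
      post_nonempty := fun t => ⟨_, rfl⟩
      inp := eA.toEmbedding.trans Function.Embedding.inl
      pinit := φ i
      pfin := φ f
      pinit_work := hwork _
      pfin_work := hwork _ }
  have hN : N.IsJSystem := by
    rintro ⟨⟨p, a, q⟩, ht⟩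
    refine ⟨eA.symm a, Sum.inr p, Sum.inr q, hwork _, hwork _, fun h => ?_, ?_, rfl⟩
    · cases h
      exact hE _ _ _ ht rfl
    · simp [N]
  refine ⟨_, T, inferInstance, inferInstance, N, hN, ?_⟩
  rw [AcceptingPT.acceptedVectors_eq_firstVisitVectors hN]
  refine firstVisitVectors_map hφ (fun p a x => ?_) i f
  constructor
  · rintro ⟨-, -, ⟨⟨p', a', q⟩, ht⟩, hpre, hpost⟩
    have hp : eQ p = p' := by
      have : (Sum.inr (eQ p) : Fin n ⊕ Fin m) ∈ N.pre ⟨⟨p', a', q⟩, ht⟩ := by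
        rw [hpre]; exact Or.inr rfl
      simpa [N] using this
    have ha : eA a = a' := by
      have : (Sum.inl (eA a) : Fin n ⊕ Fin m) ∈ N.pre ⟨⟨p', a', q⟩, ht⟩ := by
        rw [hpre]; exact Or.inl rfl
      simpa [N] using this
    subst hp ha
    refine ⟨eQ.symm q, ?_, by simpa using ht⟩
    have : x ∈ N.post ⟨⟨eQ p, eA a, q⟩, ht⟩ := by rw [hpost]; rfl
    simpa [N, φ] using this
  · rintro ⟨q, rfl, h⟩
    exact ⟨hwork _, hwork _, ⟨⟨eQ p, eA a, eQ q⟩, by simpa using h⟩, rfl, rfl⟩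

/-- The initial place is also final, and every letter enables a move out of it without return. -/
theorem acceptedByJSystem_zero [Finite A] : AcceptedByJSystem ({0} : Set (A → ℕ)) := by
  convert acceptedByJSystem_firstVisitVectors
    (fun (p : Bool) (_ : A) (q : Bool) => p = false ∧ q = true) (by rintro _ _ _ ⟨rfl, rfl⟩; simp)
    false false
  have key : ∀ (p : Bool) (v : A → ℕ) (q : Bool),
      VectorPath (fun (p : Bool) (_ : A) (q : Bool) => p = false ∧ q = true) p v q →
        q = false → p = false ∧ v = 0 := by
    intro p v q h hq
    induction h with
    | refl => exact ⟨hq, rfl⟩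
    | cons e _ ih =>
      obtain ⟨rfl, rfl⟩ := e
      exact absurd (ih hq).1 (by simp)
  ext v
  constructor
  · rintro rfl
    exact ⟨0, 0, by simp, .refl _, fun a ha => absurd rfl ha, fun s t _ _ ht => (key _ _ _ ht rfl).2⟩
  · rintro ⟨u, r, rfl, hu, hr, -⟩
    have hr0 : r = 0 := by
      ext a
      by_contra h
      exact hr a h true ⟨rfl, rfl⟩
    rw [(key _ _ _ hu rfl).2, hr0, add_zero]
    rfl

/-- The states of the automaton that simulates an automaton with states `Q` without loops and
with a final state that is never revisited. -/
inductive ControlState (Q : Type*)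
  | init : ControlState Q
  | fin : ControlState Q
  | trap : ControlState Q
  | state (q : Q) (b : Bool) : ControlState Q

namespace ControlState

instance [Finite Q] : Finite (ControlState Q) :=
  Finite.of_surjective
    (fun x : Option (Option (Option (Q × Bool))) => match x with
      | none => init
      | some none => fin
      | some (some none) => trap
      | some (some (some (q, b))) => state q b) fun
    | init => ⟨none, rfl⟩
    | fin => ⟨some none, rfl⟩
    | trap => ⟨some (some none), rfl⟩
    | state q b => ⟨some (some (some (q, b))), rfl⟩

/-- The edges of the simulating automaton, for the start states `I` and the final states `F`. -/
inductive Edge (E : Q → A → Q → Prop) (I F : Set Q) : ControlState Q → A → ControlState Q → Prop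
  | init_fin {p a q} : p ∈ I → E p a q → q ∈ F → Edge E I F init a fin
  | init_state {p a q} : p ∈ I → E p a q → Edge E I F init a (state q false)
  | state_fin {p b a q} : E p a q → q ∈ F → Edge E I F (state p b) a fin
  | state_state {p b a q} : E p a q → Edge E I F (state p b) a (state q (!b))
  | fin_trap {a} : Edge E I F fin a trap

/-- The states simulated by a control state. -/
def source (I : Set Q) : ControlState Q → Set Q
  | init => I
  | fin => ∅
  | trap => ∅
  | state q _ => {q}

variable {E : Q → A → Q → Prop} {I F : Set Q}

-- The bit in `state` flips at each step so that loops of `E` become edges between distinct places,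
-- as joins require.
omit [DecidableEq A] in
theorem Edge.ne {x y : ControlState Q} {a : A} (h : Edge E I F x a y) : x ≠ y := by
  cases h <;> simp

theorem exists_vectorPath_of_fin {x y : ControlState Q} {v : A → ℕ}
    (h : VectorPath (Edge E I F) x v y) (hy : y = fin) :
    x = fin ∧ v = 0 ∨ v ≠ 0 ∧ ∃ p ∈ source I x, ∃ q ∈ F, VectorPath E p v q := by
  induction h with
  | refl => exact .inl ⟨hy, rfl⟩
  | @cons x a x' v _ e _ ih =>
    right
    refine ⟨fun h => by simpa using congrFun h a, ?_⟩
    have ih := ih hy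
    cases e with
    | init_fin hp e hq =>
      rcases ih with ⟨-, rfl⟩ | ⟨-, _, h, -⟩
      · rw [add_zero]
        exact ⟨_, hp, _, hq, .single e⟩
      · exact h.elim
    | init_state hp e =>
      rcases ih with ⟨h, -⟩ | ⟨-, _, rfl, r, hr, h⟩
      · cases h
      · exact ⟨_, hp, r, hr, .cons e h⟩
    | state_fin e hq =>
      rcases ih with ⟨-, rfl⟩ | ⟨-, _, h, -⟩
      · rw [add_zero]
        exact ⟨_, rfl, _, hq, .single e⟩
      · exact h.elim
    | state_state e =>
      rcases ih with ⟨h, -⟩ | ⟨-, _, rfl, r, hr, h⟩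
      · cases h
      · exact ⟨_, rfl, r, hr, .cons e h⟩
    | fin_trap =>
      rcases ih with ⟨h, -⟩ | ⟨-, _, h, -⟩
      · cases h
      · exact h.elim

/-- The automaton guesses the last edge: an edge into `F` may go to `fin` or continue the
simulation. -/
theorem vectorPath_fin {x : ControlState Q} {p q : Q} {v : A → ℕ} (hp : p ∈ source I x)
    (hq : q ∈ F) (h : VectorPath E p v q) (hv : v ≠ 0) : VectorPath (Edge E I F) x v fin := by
  induction h generalizing x with
  | refl => exact absurd rfl hv
  | @cons p a p' v q e h ih =>
    have hfin : p' ∈ F → Edge E I F x a fin := fun hp' => by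
      cases x with
      | init => exact .init_fin hp e hp'
      | fin => exact hp.elim
      | trap => exact hp.elim
      | state q b => obtain rfl := hp; exact .state_fin e hp'
    have hstate : ∃ b, Edge E I F x a (state p' b) := by
      cases x with
      | init => exact ⟨_, .init_state hp e⟩
      | fin => exact hp.elim
      | trap => exact hp.elim
      | state q b => obtain rfl := hp; exact ⟨_, .state_state e⟩
    obtain ⟨b, hb⟩ := hstate
    have ih := ih (x := state p' b) rfl hq
    cases h with
    | refl => rw [add_zero]; exact .single (hfin hq)
    | @cons _ a' _ _ _ _ _ => exact .cons hb (ih fun h => by simpa using congrFun h a')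

/-- Any unread letter enables `fin_trap`, so the input must be exhausted. No path returns to `fin`,
which makes the first-visit condition automatic; zero is lost because `init ≠ fin`. -/
theorem firstVisitVectors_eq (E : Q → A → Q → Prop) (I F : Set Q) :
    firstVisitVectors (Edge E I F) init fin =
      {v | ∃ p ∈ I, ∃ q ∈ F, VectorPath E p v q} \ {0} := by
  ext v
  constructor
  · rintro ⟨u, r, rfl, hu, hr, -⟩
    have hr0 : r = 0 := by
      ext a
      by_contra h
      exact hr a h _ .fin_trap
    rw [hr0, add_zero]
    rcases exists_vectorPath_of_fin hu rfl with ⟨h, -⟩ | ⟨h0, h⟩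
    · cases h
    · exact ⟨h, h0⟩
  · rintro ⟨⟨p, hp, q, hq, h⟩, h0⟩
    refine ⟨v, 0, (add_zero v).symm, vectorPath_fin (x := init) hp hq h h0,
      fun a ha => absurd rfl ha, fun s t _ _ ht => ?_⟩
    rcases exists_vectorPath_of_fin ht rfl with ⟨-, h⟩ | ⟨-, _, h, -⟩
    · exact h
    · exact h.elim

end ControlState

theorem acceptedByJSystem_vectorPath [Finite A] [Finite Q] (E : Q → A → Q → Prop) (I F : Set Q) :
    AcceptedByJSystem ({v | ∃ p ∈ I, ∃ q ∈ F, VectorPath E p v q} \ {0}) := by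
  rw [← ControlState.firstVisitVectors_eq]
  exact acceptedByJSystem_firstVisitVectors _ (fun _ _ _ h => h.ne) _ _

/-- The edges of an automaton for finitely many linear sets with the periods `t i`: a state is the
index of a linear set together with a vector that has still to be read; when it has been read,
a new period can be started. -/
def PeriodEdge {ι : Type*} (t : ι → Set (A → ℕ)) (b : A → ℕ) (p : ι × Set.Iic b) (a : A)
    (q : ι × Set.Iic b) : Prop :=
  p.1 = q.1 ∧ ∃ x : A → ℕ, x = Pi.single a 1 + (q.2 : A → ℕ) ∧
    ((p.2 : A → ℕ) = x ∨ (p.2 : A → ℕ) = 0 ∧ x ∈ t p.1)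

namespace PeriodEdge

variable {ι : Type*} {t : ι → Set (A → ℕ)} {b : A → ℕ}

/-- Each edge either pays a letter of the debt or, at debt zero, opens a period and reads its first
letter at once. -/
theorem exists_mem_closure {p q : ι × Set.Iic b} {v : A → ℕ}
    (h : VectorPath (PeriodEdge t b) p v q) (hq : (q.2 : A → ℕ) = 0) :
    ∃ c ∈ AddSubmonoid.closure (t p.1), v = p.2 + c := by
  induction h with
  | refl p => exact ⟨0, zero_mem _, by rw [hq, add_zero]⟩
  | cons e _ ih =>
    obtain ⟨c, hc, rfl⟩ := ih hq
    obtain ⟨hi, x, rfl, h | ⟨h, hx⟩⟩ := e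
    · exact ⟨c, by rwa [hi], by rw [h, add_assoc]⟩
    · exact ⟨_, add_mem (AddSubmonoid.subset_closure hx) (by rwa [hi]), by
        rw [h, zero_add, add_assoc]⟩

theorem vectorPath_debt [Finite A] (i : ι) (d : Set.Iic b) :
    VectorPath (PeriodEdge t b) (i, d) d (i, ⟨0, Set.mem_Iic.2 zero_le⟩) := by
  obtain ⟨d, hd⟩ := d
  induction d using WellFoundedLT.induction with
  | ind d ih =>
    by_cases h0 : d = 0
    · subst h0
      exact .refl _
    · obtain ⟨a, ha⟩ := Function.ne_iff.1 h0
      have hle : d - Pi.single a 1 ≤ d := tsub_le_self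
      have hlt : d - Pi.single a 1 < d := lt_of_le_of_ne hle fun h => by
        have h₁ := congrFun h a
        simp at h₁ ha
        omega
      have h₁ := eq_single_add_sub ha
      have h₂ : VectorPath (PeriodEdge t b) (i, ⟨d, hd⟩) (Pi.single a 1 + (d - Pi.single a 1))
          (i, ⟨0, Set.mem_Iic.2 zero_le⟩) :=
        .cons (q := (i, ⟨_, hle.trans hd⟩)) ⟨rfl, d, h₁, .inl rfl⟩ (ih _ hlt (hle.trans hd))
      rwa [← h₁] at h₂

theorem vectorPath_closure [Finite A] (hb : ∀ i, ∀ x ∈ t i, x ≤ b) (i : ι) {c : A → ℕ}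
    (hc : c ∈ AddSubmonoid.closure (t i)) :
    VectorPath (PeriodEdge t b) (i, ⟨0, Set.mem_Iic.2 zero_le⟩) c (i, ⟨0, Set.mem_Iic.2 zero_le⟩) := by
  induction hc using AddSubmonoid.closure_induction with
  | mem x hx =>
    by_cases h0 : x = 0
    · subst h0
      exact .refl _
    · obtain ⟨a, ha⟩ := Function.ne_iff.1 h0
      have h₁ := eq_single_add_sub ha
      have hle : x - Pi.single a 1 ≤ b := tsub_le_self.trans (hb i x hx)
      have h₂ : VectorPath (PeriodEdge t b) (i, ⟨0, Set.mem_Iic.2 zero_le⟩)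
          (Pi.single a 1 + (x - Pi.single a 1)) (i, ⟨0, Set.mem_Iic.2 zero_le⟩) :=
        -- Opening `x` reads `a` and leaves the debt `x - Pi.single a 1`.
        .cons (q := (i, ⟨_, hle⟩)) ⟨rfl, x, h₁, .inr ⟨rfl, hx⟩⟩ (vectorPath_debt i ⟨_, hle⟩)
      rwa [← h₁] at h₂
  | zero => exact .refl _
  | add x y _ _ hx hy => exact hx.trans hy

end PeriodEdge

theorem IsSemilinearSet.acceptedByJSystem [Finite A] {S : Set (A → ℕ)} (hS : IsSemilinearSet S) :
    AcceptedByJSystem (S \ {0}) := by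
  obtain ⟨C, hC, hlin, rfl⟩ := hS
  obtain ⟨n, s, -, rfl⟩ := hC.fin_param
  choose c t ht hs using fun i => hlin (s i) ⟨i, rfl⟩
  -- A common bound on bases and periods keeps the set of debts finite; the base `c i` is the
  -- initial debt.
  obtain ⟨b, hb⟩ := (Set.finite_iUnion fun i => (ht i).insert (c i)).bddAbove
  have hbt : ∀ i, ∀ x ∈ t i, x ≤ b := fun i x hx =>
    hb (Set.mem_iUnion.2 ⟨i, Set.mem_insert_of_mem _ hx⟩)
  have hbc : ∀ i, c i ≤ b := fun i => hb (Set.mem_iUnion.2 ⟨i, Set.mem_insert _ _⟩)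
  have := Fintype.ofFinite A
  have : Finite (Set.Iic b) := Set.finite_Iic b
  convert acceptedByJSystem_vectorPath (PeriodEdge t b) {p | (p.2 : A → ℕ) = c p.1}
    {q | (q.2 : A → ℕ) = 0} using 2
  ext v
  constructor
  · rintro ⟨_, ⟨i, rfl⟩, hv⟩
    rw [hs i] at hv
    obtain ⟨y, hy, rfl⟩ := hv
    exact ⟨(i, ⟨c i, hbc i⟩), rfl, (i, ⟨0, Set.mem_Iic.2 zero_le⟩), rfl,
      (PeriodEdge.vectorPath_debt i _).trans (PeriodEdge.vectorPath_closure hbt i hy)⟩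
  · rintro ⟨p, hp, q, hq, h⟩
    obtain ⟨y, hy, rfl⟩ := PeriodEdge.exists_mem_closure h hq
    refine ⟨s p.1, ⟨p.1, rfl⟩, ?_⟩
    rw [hs, hp]
    exact ⟨y, hy, rfl⟩

end Synthesis

theorem mainTheorem1 {A : Type*} [Finite A] [Nonempty A] [DecidableEq A]
    (S : Set (A → ℕ)) (hS : S.Nonempty) :
    ((0 ∈ S → S = {0}) → (RepresentedByJLanguage S ↔ AcceptedByJSystem S)) ∧
    (AcceptedByJSystem S → RepresentedByJLanguage S) ∧
    (RepresentedByJLanguage S → AcceptedByJSystem (S \ {0})) := by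
  have h₁ : AcceptedByJSystem S → RepresentedByJLanguage S := fun h =>
    h.isSemilinearSet.representedByJLanguage hS
  have h₂ : RepresentedByJLanguage S → AcceptedByJSystem (S \ {0}) := fun h =>
    h.isSemilinearSet.acceptedByJSystem
  refine ⟨fun h0 => ⟨fun h => ?_, h₁⟩, h₁, h₂⟩
  by_cases hz : (0 : A → ℕ) ∈ S
  · rw [h0 hz]
    exact acceptedByJSystem_zero
  · rw [← Set.sdiff_singleton_eq_self hz]
    exact h₂ h
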